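/- Theorem 5.1. Let $A$ be a (not necessarily unital) complex $C^*$-algebra. For $n\in\mathbb N$ and $a\in A$ put $$\|a\|_{\mathbb M_n}=\sup\{\|\pi(a)\| : \pi\colon A\to\mathbb M_n \text{ a } {*}\text{-homomorphism}\},$$ where $\mathbb M_n$ is the algebra of complex $n\times n$ matrices with the operator norm on $\mathbb C^n$ with its standard inner product; the $*$-homomorphisms are not required to be unital or non-degenerate, so the supremum is effectively over all representations of dimension at most $n$. Let $N\ge 1$, let $0\le\lambda_1\le\lambda_2\le\dots\le\lambda_N$ be real numbers, and suppose that $A$ has (nonzero) irreducible representations of finite dimensions $n_1<n_2<\dots<n_N$ (and possibly of other dimensions as well). Then there exists $a\in A$ such that $\|a\|_{\mathbb M_{n_k}}=\lambda_k$ for all $1\le k\le N$. In addition, $a$ can be chosen such that $\|a\|=\|a\|_{\mathbb M_{n_N}}$. -/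

import Mathlib

/-- A representation of the `C⋆`-algebra `A` on the complex Hilbert space `H`: a `⋆`-homomorphism
into the bounded operators on `H`. It need not be non-degenerate, nor unital if `A` has a unit. -/
abbrev CStarRep (A : Type*) [NonUnitalCStarAlgebra A] (H : Type*) [NormedAddCommGroup H]
    [InnerProductSpace ℂ H] [CompleteSpace H] :=
  A →⋆ₙₐ[ℂ] (H →L[ℂ] H)

/-- Representations `A → 𝕄ₙ`, where `𝕄ₙ` is the algebra of operators on the Hilbert space `ℂⁿ`
with the operator norm. Since degenerate representations are allowed, these account (up to adding
zero summands) for all representations of dimension at most `n`. -/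
abbrev MatrixRep (A : Type*) [NonUnitalCStarAlgebra A] (n : ℕ) :=
  CStarRep A (EuclideanSpace ℂ (Fin n))

/-- Irreducibility: the representation is nonzero and its only closed invariant subspaces are
`0` and `H`. (The zero representation on `ℂ` is not irreducible, and neither is the one on `0`.) -/
def CStarRep.IsIrreducible {A : Type*} [NonUnitalCStarAlgebra A] {H : Type*}
    [NormedAddCommGroup H] [InnerProductSpace ℂ H] [CompleteSpace H] (π : CStarRep A H) : Prop :=
  (∃ a : A, π a ≠ 0) ∧
    ∀ V : Submodule ℂ H, IsClosed (V : Set H) → (∀ a : A, ∀ v ∈ V, π a v ∈ V) → V = ⊥ ∨ V = ⊤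

/-- `A` has an irreducible representation of dimension `n`. -/
def HasIrreducibleRepOfDim (A : Type*) [NonUnitalCStarAlgebra A] (n : ℕ) : Prop :=
  ∃ π : MatrixRep A n, CStarRep.IsIrreducible π

/-- The seminorm `‖a‖_{𝕄ₙ} = sup {‖π(a)‖ | π : A → 𝕄ₙ}`. -/
noncomputable def matrixSeminorm {A : Type*} [NonUnitalCStarAlgebra A] (n : ℕ) (a : A) : ℝ :=
  sSup {r : ℝ | ∃ π : MatrixRep A n, r = ‖π a‖}

/-- The supremum in `matrixSeminorm` is over a nonempty bounded set, so it is a genuine one. -/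
theorem isLUB_matrixSeminorm {A : Type*} [NonUnitalCStarAlgebra A] (n : ℕ) (a : A) :
    IsLUB {r : ℝ | ∃ π : MatrixRep A n, r = ‖π a‖} (matrixSeminorm n a) := by
  refine isLUB_csSup ⟨‖(0 : MatrixRep A n) a‖, 0, rfl⟩ ⟨‖a‖, ?_⟩
  rintro r ⟨π, rfl⟩
  exact NonUnitalStarAlgHom.norm_apply_le π a

/-! The seminorms are prescribed in increasing order of dimension. To raise the `n`-th one of a
positive `a` to `c ≥ ‖a‖`, add `t • b` with `b ≥ 0` killed by all representations of dimension below
`n` but not by some `n`-dimensional one; the intermediate value theorem supplies `t`. Truncation by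
`min x c` brings the norm down to `c`. It commutes with representations, so the lower seminorms
survive. Such a `b` comes from an alternating polynomial in `n ^ 2` variables: it vanishes on `m ×
m` matrices for `m < n` because `m ^ 2 < n ^ 2`, but not on matrix units of size `n`, which an
irreducible representation attains by Burnside's theorem. -/

open scoped InnerProductSpace

/-! ### Ranges of irreducible representations -/

/-- Burnside's theorem: the unital algebra generated by an irreducible finite-dimensional
representation consists of all linear maps. -/
theorem CStarRep.IsIrreducible.adjoin_range_eq_top {A : Type*} [NonUnitalCStarAlgebra A]
    {H : Type*} [NormedAddCommGroup H] [InnerProductSpace ℂ H] [CompleteSpace H]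
    [FiniteDimensional ℂ H] {π : CStarRep A H} (hπ : π.IsIrreducible) :
    Algebra.adjoin ℂ (Set.range fun a => (π a : H →ₗ[ℂ] H)) = ⊤ := by
  set R := Algebra.adjoin ℂ (Set.range fun a => (π a : H →ₗ[ℂ] H)) with hR
  have hmem (a : A) : (π a : H →ₗ[ℂ] H) ∈ R := Algebra.subset_adjoin ⟨a, rfl⟩
  have : Nontrivial H := by
    obtain ⟨a, ha⟩ := hπ.1
    by_contra h
    rw [not_nontrivial_iff_subsingleton] at h
    exact ha (Subsingleton.elim _ _)
  have hsub (W : Submodule R H) : W = ⊥ ∨ W = ⊤ := by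
    have := hπ.2 (W.restrictScalars ℂ) (Submodule.closed_of_finiteDimensional _)
      fun a v hv => W.smul_mem (⟨_, hmem a⟩ : R) hv
    simpa using this
  have : IsSimpleModule R H :=
    (isSimpleModule_iff R H).2 { eq_bot_or_eq_top := hsub }
  have schur (f : Module.End R H) : ∃ c : ℂ, ∀ v, f v = c • v := by
    obtain ⟨c, hc⟩ := Module.End.exists_eigenvalue (f.restrictScalars ℂ)
    obtain ⟨v, hv⟩ := hc.exists_hasEigenvector
    refine ⟨c, fun w => ?_⟩
    -- Schur's lemma: an eigenspace of `f` is a nonzero `R`-submodule, hence everything.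
    let W : Submodule R H := LinearMap.eqLocus f (c • LinearMap.id)
    have hvW : v ∈ W := by simpa [W] using hv.apply_eq_smul
    have hW : W = ⊤ := (hsub W).resolve_left fun h => hv.2 (by simpa [h] using hvW)
    have : w ∈ W := hW ▸ trivial
    simpa [W] using this
  refine Algebra.eq_top_iff.2 fun T => ?_
  -- All `R`-endomorphisms being scalars, `T` commutes with them, and density yields an element of
  -- `R` agreeing with `T` on a basis.
  let F : Module.End (Module.End R H) H :=
    { toFun := T
      map_add' := T.map_add
      map_smul' := fun f v => by
        obtain ⟨c, hc⟩ := schur f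
        simp [hc] }
  classical
  obtain ⟨r, hr⟩ := jacobson_density F (Finset.univ.image (Module.finBasis ℂ H))
  have : T = r := (Module.finBasis ℂ H).ext fun i =>
    hr _ (Finset.mem_image_of_mem _ (Finset.mem_univ i))
  exact this ▸ r.2

/-- The range of an irreducible finite-dimensional representation contains all operators of rank
one. -/
theorem CStarRep.IsIrreducible.exists_eq_rankOne {A : Type*} [NonUnitalCStarAlgebra A]
    {H : Type*} [NormedAddCommGroup H] [InnerProductSpace ℂ H] [CompleteSpace H]
    [FiniteDimensional ℂ H] {π : CStarRep A H} (hπ : π.IsIrreducible) (x y : H) :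
    ∃ a : A, π a = InnerProductSpace.rankOne ℂ x y := by
  -- The range of `π` is a left ideal of all operators, and by adjoints a right ideal.
  have left (T : H →L[ℂ] H) (a : A) : ∃ b, π b = T * π a := by
    have hT : (T : H →ₗ[ℂ] H) ∈ Algebra.adjoin ℂ (Set.range fun a => (π a : H →ₗ[ℂ] H)) :=
      hπ.adjoin_range_eq_top ▸ trivial
    suffices ∀ S ∈ Algebra.adjoin ℂ (Set.range fun a => (π a : H →ₗ[ℂ] H)),
        ∀ a, ∃ b, (π b : H →ₗ[ℂ] H) = S * (π a : H →ₗ[ℂ] H) by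
      obtain ⟨b, hb⟩ := this _ hT a
      exact ⟨b, ContinuousLinearMap.coe_injective hb⟩
    intro S hS
    induction hS using Algebra.adjoin_induction with
    | mem _ h => obtain ⟨c, rfl⟩ := h; exact fun a => ⟨c * a, by rw [map_mul]; rfl⟩
    | algebraMap r => exact fun a => ⟨r • a, by ext; simp⟩
    | add S T _ _ hS hT =>
      intro a
      obtain ⟨b, hb⟩ := hS a
      obtain ⟨c, hc⟩ := hT a
      exact ⟨b + c, by rw [add_mul, ← hb, ← hc, map_add]; rfl⟩
    | mul S T _ _ hS hT =>
      intro a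
      obtain ⟨b, hb⟩ := hT a
      obtain ⟨c, hc⟩ := hS b
      exact ⟨c, by rw [hc, hb, mul_assoc]⟩
  have right (a : A) (T : H →L[ℂ] H) : ∃ b, π b = π a * T := by
    obtain ⟨b, hb⟩ := left (star T) (star a)
    exact ⟨star b, by rw [map_star, hb, map_star, star_mul, star_star, star_star]⟩
  obtain ⟨a, ha⟩ := hπ.1
  obtain ⟨v, hv⟩ : ∃ v, π a v ≠ 0 := by
    by_contra! h
    exact ha (ContinuousLinearMap.ext h)
  obtain ⟨b, hb⟩ := left (InnerProductSpace.rankOne ℂ x (π a v)) a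
  obtain ⟨c, hc⟩ := right b (InnerProductSpace.rankOne ℂ v y)
  refine ⟨(⟪π a v, π a v⟫_ℂ)⁻¹ • c, ?_⟩
  ext z
  have h0 : ⟪π a v, π a v⟫_ℂ ≠ 0 := inner_self_ne_zero.2 hv
  simp only [map_smul, hc, hb, mul_apply_eq_comp, smul_apply,
    InnerProductSpace.rankOne_apply, smul_smul]
  field_simp

/-! ### Capelli polynomials -/

/-- The alternating map on a non-unital algebra whose value at `x` is the alternating sum over
the permutations `σ` of the products of the factors `y i * x (σ i) * w i`, times `z`. -/
noncomputable def capelli {R : Type*} [NonUnitalRing R] [Module ℂ R] [IsScalarTower ℂ R R]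
    [SMulCommClass ℂ R R] {m : ℕ} (y w : Fin m → R) (z : R) : R [⋀^Fin m]→ₗ[ℂ] R :=
  MultilinearMap.alternatization <|
    -- The product is formed from left multiplications in the unital algebra `Module.End ℂ R`, since
    -- `R` may lack a unit; evaluating at `z` returns to `R`.
    (LinearMap.applyₗ z).compMultilinearMap <|
      (MultilinearMap.mkPiAlgebraFin ℂ m (Module.End ℂ R)).compLinearMap fun i =>
        LinearMap.mul ℂ R ∘ₗ LinearMap.mulRight ℂ (w i) ∘ₗ LinearMap.mulLeft ℂ (y i)

theorem capelli_apply {R : Type*} [NonUnitalRing R] [Module ℂ R] [IsScalarTower ℂ R R]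
    [SMulCommClass ℂ R R] {m : ℕ} (y w : Fin m → R) (z : R) (x : Fin m → R) :
    capelli y w z x = ∑ σ : Equiv.Perm (Fin m), Equiv.Perm.sign σ •
      (List.ofFn fun i => LinearMap.mul ℂ R (y i * x (σ i) * w i)).prod z := by
  simp [capelli, MultilinearMap.alternatization_apply]

theorem map_prod_ofFn_mul {R S : Type*} [NonUnitalRing R] [Module ℂ R] [IsScalarTower ℂ R R]
    [SMulCommClass ℂ R R] [NonUnitalRing S] [Module ℂ S] [IsScalarTower ℂ S S]
    [SMulCommClass ℂ S S] (φ : R →ₙₐ[ℂ] S) {m : ℕ} (c : Fin m → R) (z : R) :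
    φ ((List.ofFn fun i => LinearMap.mul ℂ R (c i)).prod z) =
      (List.ofFn fun i => LinearMap.mul ℂ S (φ (c i))).prod (φ z) := by
  induction m with
  | zero => simp
  | succ m ih =>
    have := ih (fun i => c i.succ)
    simp_all [List.ofFn_succ]

theorem map_capelli {R S : Type*} [NonUnitalRing R] [Module ℂ R] [IsScalarTower ℂ R R]
    [SMulCommClass ℂ R R] [NonUnitalRing S] [Module ℂ S] [IsScalarTower ℂ S S]
    [SMulCommClass ℂ S S] (φ : R →ₙₐ[ℂ] S) {m : ℕ} (y w : Fin m → R) (z : R) (x : Fin m → R) :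
    φ (capelli y w z x) = capelli (φ ∘ y) (φ ∘ w) (φ z) (φ ∘ x) := by
  simp only [capelli_apply, map_sum, Units.smul_def, map_zsmul, map_prod_ofFn_mul, map_mul,
    Function.comp_apply]

theorem capelli_eq_zero_of_finrank_lt {R : Type*} [NonUnitalRing R] [Module ℂ R]
    [IsScalarTower ℂ R R] [SMulCommClass ℂ R R] [FiniteDimensional ℂ R] {m : ℕ}
    (hm : Module.finrank ℂ R < m) (y w : Fin m → R) (z : R) (x : Fin m → R) :
    capelli y w z x = 0 := by
  refine AlternatingMap.map_linearDependent _ _ fun h => ?_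
  have := h.fintype_card_le_finrank
  simp at this
  omega

/-- Every permutation other than the identity contributes a zero factor. -/
theorem capelli_eq_of_idempotent {R : Type*} [NonUnitalRing R] [Module ℂ R] [IsScalarTower ℂ R R]
    [SMulCommClass ℂ R R] {m : ℕ} {y w x : Fin m → R} {e : R} (he : e * e = e)
    (h : ∀ i j, y i * x j * w i = if i = j then e else 0) : capelli y w e x = e := by
  rw [capelli_apply, Finset.sum_eq_single 1]
  · have (k : ℕ) : ((LinearMap.mul ℂ R e) ^ k) e = e := by
      induction k with
      | zero => simp
      | succ k ih => rw [pow_succ', Module.End.mul_apply, ih]; exact he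
    simp [h, this]
  · intro σ _ hσ
    obtain ⟨i, hi⟩ : ∃ i, i ≠ σ i := by
      by_contra! hc
      exact hσ (Equiv.ext fun i => (hc i).symm)
    rw [List.prod_eq_zero]
    · simp
    · rw [List.mem_ofFn]
      exact ⟨i, by simp [h, hi]⟩
  · simp

/-! ### Matrix seminorms and truncation -/

open scoped NNReal

theorem norm_apply_le_matrixSeminorm {A : Type*} [NonUnitalCStarAlgebra A] {n : ℕ}
    (π : MatrixRep A n) (a : A) : ‖π a‖ ≤ matrixSeminorm n a :=
  (isLUB_matrixSeminorm n a).1 ⟨π, rfl⟩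

theorem matrixSeminorm_le {A : Type*} [NonUnitalCStarAlgebra A] {n : ℕ} {a : A} {c : ℝ}
    (h : ∀ π : MatrixRep A n, ‖π a‖ ≤ c) : matrixSeminorm n a ≤ c :=
  (isLUB_matrixSeminorm n a).2 fun _ ⟨π, hr⟩ => hr ▸ h π

theorem matrixSeminorm_le_norm {A : Type*} [NonUnitalCStarAlgebra A] (n : ℕ) (a : A) :
    matrixSeminorm n a ≤ ‖a‖ :=
  matrixSeminorm_le fun π => NonUnitalStarAlgHom.norm_apply_le π a

theorem matrixSeminorm_add_le {A : Type*} [NonUnitalCStarAlgebra A] (n : ℕ) (a b : A) :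
    matrixSeminorm n (a + b) ≤ matrixSeminorm n a + matrixSeminorm n b :=
  matrixSeminorm_le fun π => by
    rw [map_add]
    exact (norm_add_le _ _).trans
      (add_le_add (norm_apply_le_matrixSeminorm π a) (norm_apply_le_matrixSeminorm π b))

theorem lipschitzWith_matrixSeminorm {A : Type*} [NonUnitalCStarAlgebra A] (n : ℕ) :
    LipschitzWith 1 (matrixSeminorm n : A → ℝ) :=
  LipschitzWith.of_le_add fun a b => by
    have := matrixSeminorm_add_le n b (a - b)
    rw [add_sub_cancel] at this
    rw [dist_eq_norm]
    exact this.trans (by gcongr; exact matrixSeminorm_le_norm n _)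

theorem matrixSeminorm_add_of_map_eq_zero {A : Type*} [NonUnitalCStarAlgebra A] {n : ℕ} (a : A)
    {b : A} (hb : ∀ π : MatrixRep A n, π b = 0) :
    matrixSeminorm n (a + b) = matrixSeminorm n a := by
  simp only [matrixSeminorm, map_add, hb, add_zero]

theorem norm_cfcₙ_min {A : Type*} [NonUnitalCStarAlgebra A] [PartialOrder A] [StarOrderedRing A]
    (c : ℝ≥0) {a : A} (ha : 0 ≤ a) : ‖cfcₙ (fun x : ℝ≥0 => min x c) a‖ = min ‖a‖ c := by
  have := MonotoneOn.nnnorm_cfcₙ (fun x : ℝ≥0 => min x c) a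
    (fun x _ y _ h => min_le_min_right c h) (by fun_prop) (by simp) ha
  simpa using congrArg ((↑) : ℝ≥0 → ℝ) this

/-- Functional calculus commutes with each `π`, and a supremum of truncated norms is the truncated
supremum. -/
theorem matrixSeminorm_cfcₙ_min {A : Type*} [NonUnitalCStarAlgebra A] [PartialOrder A]
    [StarOrderedRing A] (n : ℕ) (c : ℝ≥0) {a : A} (ha : 0 ≤ a) :
    matrixSeminorm n (cfcₙ (fun x : ℝ≥0 => min x c) a) = min (matrixSeminorm n a) c := by
  have key (π : MatrixRep A n) : ‖π (cfcₙ (fun x : ℝ≥0 => min x c) a)‖ = min ‖π a‖ c := by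
    have hπa : 0 ≤ π a := map_nonneg π ha
    rw [NonUnitalStarAlgHom.map_cfcₙ π (fun x : ℝ≥0 => min x c) a (by fun_prop) (by simp)
      (map_continuous π) ha hπa, norm_cfcₙ_min c hπa]
  apply le_antisymm
  · refine matrixSeminorm_le fun π => ?_
    rw [key]
    exact min_le_min_right _ (norm_apply_le_matrixSeminorm π a)
  · by_contra! h
    rw [lt_min_iff] at h
    refine h.1.not_ge (matrixSeminorm_le fun π => ?_)
    have := norm_apply_le_matrixSeminorm π (cfcₙ (fun x : ℝ≥0 => min x c) a)
    rw [key, min_le_iff] at this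
    exact this.resolve_right h.2.not_ge

/-! ### Elements killed by small representations -/

/-- If `A` has an irreducible representation of dimension `n`, then the ideal of elements killed by
all representations of dimension less than `n` is not killed by it. -/
theorem CStarRep.IsIrreducible.exists_apply_ne_zero {A : Type*} [NonUnitalCStarAlgebra A] {n : ℕ}
    {π : MatrixRep A n} (hπ : CStarRep.IsIrreducible π) :
    ∃ b : A, π b ≠ 0 ∧ ∀ m < n, ∀ ρ : MatrixRep A m, ρ b = 0 := by
  let u (i : Fin n) : EuclideanSpace ℂ (Fin n) := EuclideanSpace.basisFun (Fin n) ℂ i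
  have hu (i j : Fin n) : inner ℂ (u i) (u j) = if i = j then (1 : ℂ) else 0 :=
    (EuclideanSpace.basisFun (Fin n) ℂ).inner_eq_ite i j
  choose g hg using fun i j : Fin n => hπ.exists_eq_rankOne (u i) (u j)
  have hn : 0 < n := by
    obtain ⟨a, ha⟩ := hπ.1
    by_contra! h
    obtain rfl : n = 0 := by omega
    exact ha (Subsingleton.elim _ _)
  have hmul (i j k l : Fin n) : π (g i j) * π (g k l) = if j = k then π (g i l) else 0 := by
    simp only [hg, ContinuousLinearMap.mul_def, InnerProductSpace.rankOne_comp_rankOne, hu]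
    split <;> simp
  let o : Fin n := ⟨0, hn⟩
  have p : Fin (n * n) ≃ Fin n × Fin n := finProdFinEquiv.symm
  -- The `g i j` lift matrix units, whose relations hold only after applying `π`. Sandwiching the
  -- `j`-th one between the `i`-th outer factors gives the corner unit if `i = j` and zero
  -- otherwise.
  let b := capelli (fun i => g o (p i).1) (fun i => g (p i).2 o) (g o o)
    (fun i => g (p i).1 (p i).2)
  refine ⟨b, ?_, fun m hm ρ => ?_⟩
  · have : π b = π (g o o) := by
      refine (map_capelli π.toNonUnitalAlgHom _ _ _ _).trans (capelli_eq_of_idempotent ?_ ?_)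
      · exact (hmul o o o o).trans (if_pos rfl)
      · intro i j
        change π (g o (p i).1) * π (g (p j).1 (p j).2) * π (g (p i).2 o) =
          if i = j then π (g o o) else 0
        rw [hmul]
        rcases eq_or_ne i j with rfl | hij
        · simp [hmul]
        · rw [if_neg hij]
          split_ifs with h1
          · rw [hmul, if_neg]
            exact fun h2 => hij (p.injective (Prod.ext h1 h2.symm))
          · simp
    rw [this, hg]
    have h0 : u o ≠ 0 := fun h => by simpa [h] using hu o o
    exact InnerProductSpace.rankOne_ne_zero h0 h0
  · refine (map_capelli ρ.toNonUnitalAlgHom _ _ _ _).trans (capelli_eq_zero_of_finrank_lt ?_ _ _ _ _)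
    rw [← (LinearMap.toContinuousLinearMap (𝕜 := ℂ) (E := EuclideanSpace ℂ (Fin m))
      (F' := EuclideanSpace ℂ (Fin m))).finrank_eq, Module.finrank_linearMap]
    simpa using Nat.mul_self_lt_mul_self hm

theorem HasIrreducibleRepOfDim.exists_nonneg {A : Type*} [NonUnitalCStarAlgebra A]
    [PartialOrder A] [StarOrderedRing A] {n : ℕ} (h : HasIrreducibleRepOfDim A n) :
    ∃ b : A, 0 ≤ b ∧ (∃ π : MatrixRep A n, π b ≠ 0) ∧ ∀ m < n, ∀ ρ : MatrixRep A m, ρ b = 0 := by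
  obtain ⟨π, hπ⟩ := h
  obtain ⟨b, hb, hb0⟩ := hπ.exists_apply_ne_zero
  refine ⟨star b * b, star_mul_self_nonneg b, ⟨π, ?_⟩, fun m hm ρ => ?_⟩
  · rwa [map_mul, map_star, Ne, CStarRing.star_mul_self_eq_zero_iff]
  · rw [map_mul, hb0 m hm ρ, mul_zero]

/-! ### Raising the seminorms one by one -/

/-- The norm and the seminorm `‖·‖_{𝕄ₙ}` of a positive element can be raised to a prescribed common
value, without changing the seminorms `‖·‖_{𝕄ₘ}` for `m < n`. -/
theorem HasIrreducibleRepOfDim.exists_matrixSeminorm_eq {A : Type*} [NonUnitalCStarAlgebra A]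
    [PartialOrder A] [StarOrderedRing A] {n : ℕ} (h : HasIrreducibleRepOfDim A n) {a : A}
    (ha : 0 ≤ a) {c : ℝ} (hc : ‖a‖ ≤ c) :
    ∃ a' : A, 0 ≤ a' ∧ ‖a'‖ = c ∧ matrixSeminorm n a' = c ∧
      ∀ m < n, matrixSeminorm m a' = matrixSeminorm m a := by
  obtain ⟨b, hb, ⟨π, hπ⟩, hb0⟩ := h.exists_nonneg
  let f : ℝ → ℝ := fun t => matrixSeminorm n (a + t • b)
  have hf : Continuous f :=
    (lipschitzWith_matrixSeminorm n).continuous.comp (by fun_prop)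
  have hpos : 0 < ‖π b‖ := norm_pos_iff.2 hπ
  -- Chosen so that `‖T • π b‖ - ‖π a‖ = |c|`, whence `‖π (a + T • b)‖ ≥ c`.
  let T : ℝ := (|c| + ‖π a‖) / ‖π b‖
  have hT : 0 ≤ T := by positivity
  have hfT : c ≤ f T := by
    refine le_trans ?_ (norm_apply_le_matrixSeminorm π _)
    have h1 : π (T • b) = T • π b := by
      simpa only [Complex.coe_smul] using map_smul π (T : ℂ) b
    have h2 : ‖T • π b‖ = |c| + ‖π a‖ := by
      rw [norm_smul, Real.norm_of_nonneg hT, div_mul_cancel₀ _ hpos.ne']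
    have h3 := norm_sub_le (π a + T • π b) (π a)
    rw [add_sub_cancel_left, h2] at h3
    rw [map_add, h1]
    linarith [le_abs_self c]
  obtain ⟨t, ht, hft⟩ := intermediate_value_Icc hT hf.continuousOn
    (show c ∈ Set.Icc (f 0) (f T) from ⟨by simpa [f] using (matrixSeminorm_le_norm n a).trans hc, hfT⟩)
  have ha' : 0 ≤ a + t • b := add_nonneg ha (smul_nonneg ht.1 hb)
  lift c to ℝ≥0 using (norm_nonneg a).trans hc
  have hn : matrixSeminorm n (cfcₙ (fun x : ℝ≥0 => min x c) (a + t • b)) = c := by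
    rw [matrixSeminorm_cfcₙ_min n c ha']
    exact min_eq_right hft.ge
  refine ⟨cfcₙ (fun x : ℝ≥0 => min x c) (a + t • b), cfcₙ_nonneg_of_predicate, ?_, hn,
    fun m hm => ?_⟩
  · refine le_antisymm ?_ (hn.ge.trans (matrixSeminorm_le_norm n _))
    rw [norm_cfcₙ_min c ha']
    exact min_le_right _ _
  -- Below dimension `n` the summand `t • b` is invisible, and truncation at `c ≥ ‖a‖` has no
  -- effect.
  · rw [matrixSeminorm_cfcₙ_min m c ha', matrixSeminorm_add_of_map_eq_zero a fun ρ => ?_]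
    · exact min_eq_left ((matrixSeminorm_le_norm m a).trans hc)
    · have : ρ (t • b) = t • ρ b := by
        simpa only [Complex.coe_smul] using map_smul ρ (t : ℂ) b
      rw [this, hb0 m hm ρ, smul_zero]

/-- Positivity and `‖a‖ = lam N` feed the induction: the next step needs `‖a‖ ≤ lam (N + 1)`. -/
theorem exists_nonneg_forall_matrixSeminorm_eq {A : Type*} [NonUnitalCStarAlgebra A]
    [PartialOrder A] [StarOrderedRing A] {N : ℕ} (hN : 1 ≤ N)
    {n : ℕ → ℕ} (hn : StrictMonoOn n (Set.Icc 1 N))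
    (hA : ∀ k ∈ Set.Icc 1 N, HasIrreducibleRepOfDim A (n k))
    {lam : ℕ → ℝ} (hlam_nonneg : 0 ≤ lam 1) (hlam : MonotoneOn lam (Set.Icc 1 N)) :
    ∃ a : A, 0 ≤ a ∧ (∀ k ∈ Set.Icc 1 N, matrixSeminorm (n k) a = lam k) ∧ ‖a‖ = lam N := by
  induction N, hN using Nat.le_induction with
  | base =>
    obtain ⟨a, ha, hna, hsa, -⟩ :=
      (hA 1 (by simp)).exists_matrixSeminorm_eq le_rfl (norm_zero.trans_le hlam_nonneg)
    refine ⟨a, ha, fun k hk => ?_, hna⟩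
    obtain rfl : k = 1 := by simpa using hk
    exact hsa
  | succ N hN ih =>
    have hsub : Set.Icc 1 N ⊆ Set.Icc 1 (N + 1) := Set.Icc_subset_Icc_right (by omega)
    have hmem : N + 1 ∈ Set.Icc 1 (N + 1) := by simp
    obtain ⟨a, ha, hk, hna⟩ := ih (hn.mono hsub) (fun k hk => hA k (hsub hk)) (hlam.mono hsub)
    obtain ⟨a', ha', hna', hsa', hlt⟩ := (hA (N + 1) hmem).exists_matrixSeminorm_eq ha
      (hna.trans_le (hlam (hsub ⟨hN, le_rfl⟩) hmem (by omega)))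
    refine ⟨a', ha', fun k hk' => ?_, hna'⟩
    rcases hk'.2.eq_or_lt with rfl | hkN
    · exact hsa'
    · rw [hlt _ (hn hk' hmem hkN), hk k ⟨hk'.1, by omega⟩]

theorem theorem5p1 {A : Type*} [NonUnitalCStarAlgebra A] (N : ℕ) (hN : 1 ≤ N)
    (n : ℕ → ℕ) (hn : StrictMonoOn n (Set.Icc 1 N))
    (hA : ∀ k ∈ Set.Icc 1 N, HasIrreducibleRepOfDim A (n k))
    (lam : ℕ → ℝ) (hlam_nonneg : 0 ≤ lam 1) (hlam : MonotoneOn lam (Set.Icc 1 N)) :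
    ∃ a : A, (∀ k ∈ Set.Icc 1 N, matrixSeminorm (n k) a = lam k) ∧
      ‖a‖ = matrixSeminorm (n N) a := by
  let _ := CStarAlgebra.spectralOrder A
  have := CStarAlgebra.spectralOrderedRing A
  obtain ⟨a, -, hk, hna⟩ := exists_nonneg_forall_matrixSeminorm_eq hN hn hA hlam_nonneg hlam
  exact ⟨a, hk, hna.trans (hk N ⟨hN, le_rfl⟩).symm⟩
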